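/- Let $\Bbbk$ be a field of characteristic $0$ and $H=\Bbbk[D]$, a Hopf algebra with $\Delta(D)=D\otimes 1+1\otimes D$; let $\Delta^{(n)}:H\to H^{\otimes n}$ be the iterated coproduct ($\Delta^{(1)}=\mathrm{id}$), and let $h\in H$ act on $H^{\otimes n}$ as multiplication by $\Delta^{(n)}(h)$. Let $C$ be a conformal algebra over $\Bbbk$: a unital $H$-module with $\Bbbk$-bilinear operations $a\circ_s b$, $s\ge 0$, such that for all $a,b\in C$ one has $a\circ_s b=0$ for all sufficiently large $s$, and $Da\circ_s b=-s\,a\circ_{s-1}b$, $a\circ_s Db=D(a\circ_s b)+s\,a\circ_{s-1}b$ for all $s\ge 0$. Its coefficient algebra $\operatorname{Coeff} C$ is the (non-associative) $\Bbbk$-algebra $\Bbbk[t,t^{-1}]\otimes_H C$, where $t^mD=-m\,t^{m-1}$, with the product given, for $a(m)=t^m\otimes_H a$, by $$a(m)\,b(l)=\sum_{s\ge 0}\binom{m}{s}(a\circ_s b)(m+l-s),\qquad m,l\in\mathbb Z .$$ View $C$ as an $H$-pseudoalgebra with the pseudoproduct $$a*b=\sum_{s\ge 0}\Big(\frac{(-D)^s}{s!}\otimes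 1\Big)\otimes_H (a\circ_s b)\in (H\otimes H)\otimes_H C,$$ and extend $*$ to the expanded pseudoproduct $(H^{\otimes p}\otimes_H C)\otimes(H^{\otimes q}\otimes_H C)\to H^{\otimes(p+q)}\otimes_H C$ by $$(F\otimes_H a)*(G\otimes_H b)=(F\otimes G\otimes_H 1)\,(\Delta^{(p)}\otimes\Delta^{(q)}\otimes_H \mathrm{id}_C)(a*b).$$ Let $$f(a_1,\dots,a_n)=\sum_{\sigma\in S_n}t_\sigma(a_{\sigma(1)},\dots,a_{\sigma(n)})$$ be a homogeneous multilinear non-associative polynomial over $\Bbbk$, where each $t_\sigma(b_1,\dots,b_n)$ is a $\Bbbk$-linear combination of bracketings of the word $b_1\cdots b_n$. Let $t_\sigma^*(b_1,\dots,b_n)\in H^{\otimes n}\otimes_H C$ be obtained from $t_\sigma$ by replacing every letter $b\in C$ by $1\otimes_H b\in H\otimes_H C$ and every product by the expanded pseudoproduct, and put $$f^*(a_1,\dots,a_n)=\sum_{\sigma\in S_n}(\sigma\otimes_H \mathrm{id}_C)\,t_\sigma^*(a_{\sigma(1)},\dots,a_{\sigma(n)}),$$ where $\sigma$ acts on $H^{\otimes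 n}$ by moving the $i$-th tensor factor to the position $\sigma(i)$. If $\operatorname{Coeff} C$ satisfies the identity $f=0$, i.e. $f(u_1,\dots,u_n)=0$ for all $u_1,\dots,u_n\in\operatorname{Coeff} C$, then $C$ satisfies the pseudo-identity $f^*=0$, i.e. $f^*(a_1,\dots,a_n)=0$ in $H^{\otimes n}\otimes_H C$ for all $a_1,\dots,a_n\in C$. -/

import Mathlib

open Polynomial LaurentPolynomial TensorProduct

noncomputable section

/-! ## Auxiliary facts on additive maps -/

/-- A biadditive map, as an additive map into additive maps. -/
def biAdd {A B M : Type*} [AddCommGroup A] [AddCommGroup B] [AddCommGroup M] (f : A → B → M)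
    (h₁ : ∀ a a' b, f (a + a') b = f a b + f a' b)
    (h₂ : ∀ a b b', f a (b + b') = f a b + f a b') : A →+ B →+ M :=
  AddMonoidHom.mk' (fun a => AddMonoidHom.mk' (f a) (h₂ a))
    (fun a a' => AddMonoidHom.ext fun b => h₁ a a' b)

@[simp] theorem biAdd_apply {A B M : Type*} [AddCommGroup A] [AddCommGroup B] [AddCommGroup M]
    (f : A → B → M) (h₁ : ∀ a a' b, f (a + a') b = f a b + f a' b)
    (h₂ : ∀ a b b', f a (b + b') = f a b + f a b') (a : A) (b : B) :
    biAdd f h₁ h₂ a b = f a b := rfl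

theorem addHom_ext_tmul {R A B M : Type*} [CommRing R] [AddCommGroup A] [AddCommGroup B]
    [Module R A] [Module R B] [AddCommGroup M] {f g : A ⊗[R] B →+ M}
    (h : ∀ a b, f (a ⊗ₜ[R] b) = g (a ⊗ₜ[R] b)) : f = g := by
  refine AddMonoidHom.ext fun x => ?_
  induction x using TensorProduct.induction_on with
  | zero => simp
  | add x y hx hy => simp only [map_add, hx, hy]
  | tmul a b => exact h a b

theorem poly_induct {k : Type*} [Field k] {p : k[X] → Prop} (hC : ∀ c, p (Polynomial.C c))
    (hX : p X) (hadd : ∀ f g, p f → p g → p (f + g)) (hmul : ∀ f g, p f → p g → p (f * g))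
    (h : k[X]) : p h := by
  induction h using Polynomial.induction_on with
  | C c => exact hC c
  | add f g hf hg => exact hadd f g hf hg
  | monomial n c hn =>
    rw [pow_succ, ← mul_assoc]
    exact hmul _ _ hn hX

/-! ## The Hopf algebra `H = k[D]`

`H` is `k[X]`, the variable `X` being written `D` in the literature. -/

/-- The tensor power `H^{⊗ n}` over `k` of `H = k[X]`. -/
def TPow (k : Type*) [Field k] (n : ℕ) : Type _ :=
  PiTensorProduct k (fun _ : Fin n => k[X])

namespace TPow

variable {k : Type*} [Field k]

instance instCommRing (n : ℕ) : CommRing (TPow k n) :=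
  inferInstanceAs (CommRing (PiTensorProduct k (fun _ : Fin n => k[X])))

instance instAlgebra (n : ℕ) : Algebra k (TPow k n) :=
  inferInstanceAs (Algebra k (PiTensorProduct k (fun _ : Fin n => k[X])))

/-- The pure tensor `f₁ ⊗ ⋯ ⊗ fₙ`. -/
def pure {n : ℕ} (f : Fin n → k[X]) : TPow k n := PiTensorProduct.tprod k f

/-- The algebra map `h ↦ 1 ⊗ ⋯ ⊗ h ⊗ ⋯ ⊗ 1`, with `h` in position `i`. -/
def single {n : ℕ} (i : Fin n) : k[X] →ₐ[k] TPow k n :=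
  PiTensorProduct.singleAlgHom (R := k) (A := fun _ : Fin n => k[X]) i

/-- The algebra map `f₁ ⊗ ⋯ ⊗ fₙ ↦ g₁(f₁) ⋯ gₙ(fₙ)` into a commutative algebra. -/
def lift {n : ℕ} {S : Type*} [CommRing S] [Algebra k S] (g : Fin n → k[X] →ₐ[k] S) :
    TPow k n →ₐ[k] S :=
  PiTensorProduct.liftAlgHom
    ((MultilinearMap.mkPiAlgebra k (Fin n) S).compLinearMap (fun i => (g i).toLinearMap))
    (by simp) (by intro x y; simp [Finset.prod_mul_distrib])

@[simp] theorem lift_pure {n : ℕ} {S : Type*} [CommRing S] [Algebra k S]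
    (g : Fin n → k[X] →ₐ[k] S) (f : Fin n → k[X]) : lift g (pure f) = ∏ i, g i (f i) := by
  simp only [lift, pure, PiTensorProduct.liftAlgHom]
  erw [PiTensorProduct.lift.tprod]
  simp

theorem single_apply {n : ℕ} (i : Fin n) (f : k[X]) :
    single i f = pure (Pi.mulSingle i f) := rfl

theorem prod_pure {n : ℕ} {ι : Type*} (s : Finset ι) (f : ι → Fin n → k[X]) :
    ∏ j ∈ s, pure (f j) = pure (∏ j ∈ s, f j) :=
  (PiTensorProduct.tprod_prod s f).symm

theorem pure_mul_pure {n : ℕ} (f g : Fin n → k[X]) : pure f * pure g = pure (f * g) :=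
  PiTensorProduct.tprod_mul_tprod f g

theorem prod_single {n : ℕ} (f : Fin n → k[X]) : ∏ i, single i (f i) = pure f := by
  simp only [single_apply, prod_pure, Finset.univ_prod_mulSingle]

@[simp] theorem lift_single {n : ℕ} {S : Type*} [CommRing S] [Algebra k S]
    (g : Fin n → k[X] →ₐ[k] S) (i : Fin n) (f : k[X]) : lift g (single i f) = g i f := by
  rw [single_apply, lift_pure, Finset.prod_eq_single i]
  · simp
  · intro j _ hj
    simp [Pi.mulSingle_eq_of_ne hj]
  · simp

/-- The iterated coproduct `Δ^{(n)} : H → H^{⊗ n}`: the algebra map which sends `D` to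
`∑ i, 1 ⊗ ⋯ ⊗ D ⊗ ⋯ ⊗ 1`. In particular `Δ^{(2)} = Δ`. -/
def coprod (k : Type*) [Field k] (n : ℕ) : k[X] →ₐ[k] TPow k n :=
  aeval (∑ i : Fin n, single i X)

@[simp] theorem coprod_X (n : ℕ) : coprod k n X = ∑ i : Fin n, single i X := by
  simp [coprod]

/-- `Δ^{(1)} = id`. -/
theorem coprod_one (f : k[X]) : coprod k 1 f = pure ![f] := by
  have h : coprod k 1 = single (0 : Fin 1) := by
    apply Polynomial.algHom_ext
    simp
  rw [h, ← prod_single]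
  simp

/-- `H^{⊗ n}` as an `H`-module: `h` acts as multiplication by `Δ^{(n)}(h)`. -/
instance instAlgebraPolynomial (n : ℕ) : Algebra k[X] (TPow k n) :=
  (coprod k n).toRingHom.toAlgebra

theorem algebraMap_eq (n : ℕ) (h : k[X]) : algebraMap k[X] (TPow k n) h = coprod k n h := rfl

theorem smul_eq (n : ℕ) (h : k[X]) (F : TPow k n) : h • F = coprod k n h * F := rfl

instance instIsScalarTower (n : ℕ) : IsScalarTower k k[X] (TPow k n) :=
  IsScalarTower.of_algebraMap_eq fun c => by
    rw [algebraMap_eq, ← AlgHom.commutes (coprod k n) c]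

/-- An algebra map `H^{⊗ n} → H^{⊗ m}` compatible with the coproducts, as an `H`-linear map. -/
def toHLinear {n m : ℕ} (g : TPow k n →ₐ[k] TPow k m)
    (hg : g (coprod k n X) = coprod k m X) : TPow k n →ₗ[k[X]] TPow k m where
  toFun := g
  map_add' := map_add g
  map_smul' h F := by
    have e : g.comp (coprod k n) = coprod k m := Polynomial.algHom_ext hg
    rw [smul_eq, map_mul, RingHom.id_apply, smul_eq, ← e]
    rfl

/-- `F ↦ F ⊗ 1`, from `H^{⊗ n}` to `H^{⊗ (n+m)}`. -/
def inl (k : Type*) [Field k] (n m : ℕ) : TPow k n →ₐ[k] TPow k (n + m) :=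
  lift fun i => single (Fin.castAdd m i)

/-- `G ↦ 1 ⊗ G`, from `H^{⊗ m}` to `H^{⊗ (n+m)}`. -/
def inr (k : Type*) [Field k] (n m : ℕ) : TPow k m →ₐ[k] TPow k (n + m) :=
  lift fun j => single (Fin.natAdd n j)

/-- The element `F ⊗ G` of `H^{⊗ (n+m)}`, for `F ∈ H^{⊗ n}` and `G ∈ H^{⊗ m}`. -/
def outer {n m : ℕ} (F : TPow k n) (G : TPow k m) : TPow k (n + m) :=
  inl k n m F * inr k n m G

theorem outer_pure {n m : ℕ} (f : Fin n → k[X]) (g : Fin m → k[X]) :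
    outer (pure f) (pure g) = pure (Fin.append f g) := by
  rw [← prod_single (Fin.append f g), Fin.prod_univ_add]
  simp [outer, inl, inr]

/-- `Δ^{(n)} ⊗ Δ^{(m)} : H ⊗ H → H^{⊗ (n+m)}`. -/
def coprodPair (k : Type*) [Field k] (n m : ℕ) : TPow k 2 →ₐ[k] TPow k (n + m) :=
  lift ![(inl k n m).comp (coprod k n), (inr k n m).comp (coprod k m)]

theorem coprodPair_pure (n m : ℕ) (f g : k[X]) :
    coprodPair k n m (pure ![f, g]) = outer (coprod k n f) (coprod k m g) := by
  simp [coprodPair, outer, Fin.prod_univ_two]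

/-- `(Δ^{(n)} ⊗ Δ^{(m)}) Δ = Δ^{(n+m)}`; for `n = 1` this is the usual recursion. -/
theorem coprodPair_coprod (n m : ℕ) :
    coprodPair k n m (coprod k 2 X) = coprod k (n + m) X := by
  simp [coprodPair, inl, inr, Fin.sum_univ_add, Fin.sum_univ_two]

/-- The action of `σ` on `H^{⊗ n}`: the factor in position `i` is moved to position `σ i`. -/
def perm {n : ℕ} (σ : Equiv.Perm (Fin n)) : TPow k n →ₐ[k] TPow k n :=
  lift fun i => single (σ i)

theorem perm_pure {n : ℕ} (σ : Equiv.Perm (Fin n)) (f : Fin n → k[X]) :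
    perm σ (pure f) = pure (fun j => f (σ.symm j)) := by
  rw [← prod_single (fun j => f (σ.symm j)), ← Equiv.prod_comp σ]
  simp [perm]

theorem perm_coprod {n : ℕ} (σ : Equiv.Perm (Fin n)) :
    perm σ (coprod k n X) = coprod k n X := by
  simp only [coprod_X, map_sum, perm, lift_single]
  exact Equiv.sum_comp σ (fun i => single i (X : k[X]))

end TPow

/-- `H^{⊗ n} ⊗_H P`, where `H` acts on `H^{⊗ n}` through `Δ^{(n)}`. -/
abbrev HTensor (k : Type*) [Field k] (n : ℕ) (P : Type*) [AddCommGroup P] [Module k[X] P] :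
    Type _ :=
  TPow k n ⊗[k[X]] P

/-! ## Pseudoalgebras over `H = k[D]` -/

/-- An `H`-pseudoalgebra: an `H`-module `P` with an `H`-bilinear map
`P ⊗ P → (H ⊗ H) ⊗_H P`. -/
class Pseudoalgebra (k P : Type*) [Field k] [AddCommGroup P] [Module k P] [Module k[X] P]
    [IsScalarTower k k[X] P] where
  /-- The pseudoproduct `a * b`. -/
  pprod : P →ₗ[k] P →ₗ[k] HTensor k 2 P
  smul_pprod_smul : ∀ (f g : k[X]) (a b : P),
    pprod (f • a) (g • b) = TPow.pure ![f, g] • pprod a b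

namespace Pseudoalgebra

variable {k P : Type*} [Field k] [AddCommGroup P] [Module k P] [Module k[X] P]
  [IsScalarTower k k[X] P]

/-- `Δ^{(n)} ⊗ Δ^{(m)} ⊗_H id : (H ⊗ H) ⊗_H P → H^{⊗ (n+m)} ⊗_H P`. -/
def coprodPairTensor (k P : Type*) [Field k] [AddCommGroup P] [Module k[X] P] (n m : ℕ) :
    HTensor k 2 P →ₗ[k[X]] HTensor k (n + m) P :=
  LinearMap.rTensor P (TPow.toHLinear (TPow.coprodPair k n m) (TPow.coprodPair_coprod n m))

theorem coprodPairTensor_smul (n m : ℕ) (F : TPow k 2) (x : HTensor k 2 P) :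
    coprodPairTensor k P n m (F • x) = TPow.coprodPair k n m F • coprodPairTensor k P n m x := by
  induction x using TensorProduct.induction_on with
  | zero => simp
  | add x y hx hy => simp only [smul_add, map_add, hx, hy]
  | tmul G p =>
    simp [coprodPairTensor, TensorProduct.smul_tmul', TPow.toHLinear]

variable [Pseudoalgebra k P]

/-- `(F ⊗ G ⊗_H 1) (Δ^{(n)} ⊗ Δ^{(m)} ⊗_H id)(a * b)`. -/
def preExpanded {n m : ℕ} (F : TPow k n) (a : P) (G : TPow k m) (b : P) : HTensor k (n + m) P :=
  TPow.outer F G • coprodPairTensor k P n m (pprod (k := k) a b)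

theorem preExpanded_smul_left {n m : ℕ} (h : k[X]) (F : TPow k n) (a : P) (G : TPow k m) (b : P) :
    preExpanded (h • F) a G b = preExpanded F (h • a) G b := by
  have e := smul_pprod_smul (k := k) h 1 a b
  rw [one_smul] at e
  simp only [preExpanded, e, coprodPairTensor_smul, TPow.coprodPair_pure, smul_smul, TPow.smul_eq,
    TPow.outer, map_mul, map_one]
  congr 1
  ring

theorem preExpanded_smul_right {n m : ℕ} (h : k[X]) (F : TPow k n) (a : P) (G : TPow k m) (b : P) :
    preExpanded F a (h • G) b = preExpanded F a G (h • b) := by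
  have e := smul_pprod_smul (k := k) 1 h a b
  rw [one_smul] at e
  simp only [preExpanded, e, coprodPairTensor_smul, TPow.coprodPair_pure, smul_smul, TPow.smul_eq,
    TPow.outer, map_mul, map_one]
  congr 1
  ring

/-- The map `x ↦ (F ⊗_H a) * x`. -/
def expandedRight {n : ℕ} (m : ℕ) (F : TPow k n) (a : P) :
    HTensor k m P →+ HTensor k (n + m) P :=
  TensorProduct.liftAddHom
    (biAdd (fun (G : TPow k m) (b : P) => preExpanded F a G b)
      (fun G G' b => by simp only [preExpanded, TPow.outer, map_add, mul_add, add_smul])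
      (fun G b b' => by simp only [preExpanded, map_add, smul_add]))
    (fun h G b => preExpanded_smul_right h F a G b)

theorem expandedRight_tmul {n m : ℕ} (F : TPow k n) (a : P) (G : TPow k m) (b : P) :
    expandedRight m F a (G ⊗ₜ[k[X]] b) = preExpanded F a G b := rfl

/-- The expanded pseudoproduct
`(H^{⊗ n} ⊗_H P) × (H^{⊗ m} ⊗_H P) → H^{⊗ (n+m)} ⊗_H P`. -/
def expanded {n m : ℕ} : HTensor k n P →+ HTensor k m P →+ HTensor k (n + m) P :=
  TensorProduct.liftAddHom
    (biAdd (fun (F : TPow k n) (a : P) => expandedRight m F a)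
      (fun F F' a => addHom_ext_tmul fun G b => by
        simp only [AddMonoidHom.add_apply, expandedRight_tmul, preExpanded, TPow.outer, map_add,
          add_mul, add_smul])
      (fun F a a' => addHom_ext_tmul fun G b => by
        simp only [AddMonoidHom.add_apply, expandedRight_tmul, preExpanded, map_add,
          LinearMap.add_apply, smul_add]))
    (fun h F a => addHom_ext_tmul fun G b => preExpanded_smul_left h F a G b)

/-- `(F ⊗_H a) * (G ⊗_H b) = (F ⊗ G ⊗_H 1) (Δ^{(n)} ⊗ Δ^{(m)} ⊗_H id)(a * b)`. -/
theorem expanded_tmul {n m : ℕ} (F : TPow k n) (a : P) (G : TPow k m) (b : P) :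
    expanded (F ⊗ₜ[k[X]] a) (G ⊗ₜ[k[X]] b) =
      TPow.outer F G • coprodPairTensor k P n m (pprod (k := k) a b) := rfl

end Pseudoalgebra

/-! ## Conformal algebras -/

/-- A conformal algebra over `k`: a `k[D]`-module with bilinear `n`-products, `n ≥ 0`, which are
local and sesqui-linear. (For `n = 0` the index `n - 1` occurs with coefficient `0`.) -/
class ConformalAlgebra (k C : Type*) [Field k] [AddCommGroup C] [Module k C] [Module k[X] C]
    [IsScalarTower k k[X] C] where
  /-- The `n`-th product. -/
  nprod : ℕ → C →ₗ[k] C →ₗ[k] C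
  locality : ∀ a b : C, ∃ N : ℕ, ∀ n, N ≤ n → nprod n a b = 0
  nprod_D_left : ∀ (n : ℕ) (a b : C),
    nprod n ((X : k[X]) • a) b = -((n : k) • nprod (n - 1) a b)
  nprod_D_right : ∀ (n : ℕ) (a b : C),
    nprod n a ((X : k[X]) • b) = (X : k[X]) • nprod n a b + (n : k) • nprod (n - 1) a b

namespace ConformalAlgebra

variable {k C : Type*} [Field k] [AddCommGroup C] [Module k C] [Module k[X] C]
  [IsScalarTower k k[X] C] [ConformalAlgebra k C]

/-- The finitely supported family of all products `n ↦ nprod n a b`. -/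
def nprods : C →ₗ[k] C →ₗ[k] (ℕ →₀ C) :=
  LinearMap.mk₂ k
    (fun a b => Finsupp.ofSupportFinite (fun n => nprod (k := k) n a b) (by
      obtain ⟨N, hN⟩ := locality (k := k) a b
      refine (Set.finite_lt_nat N).subset fun n hn => ?_
      by_contra h
      exact hn (hN n (not_lt.mp h))))
    (fun a a' b => by ext n; simp [Finsupp.ofSupportFinite_coe])
    (fun c a b => by ext n; simp [Finsupp.ofSupportFinite_coe])
    (fun a b b' => by ext n; simp [Finsupp.ofSupportFinite_coe])
    (fun c a b => by ext n; simp [Finsupp.ofSupportFinite_coe])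

@[simp] theorem nprods_apply (a b : C) (n : ℕ) :
    nprods (k := k) a b n = nprod (k := k) n a b := rfl

/-- The finite sum `∑ s, g s (nprod s a b)`. -/
def sumProd {M : Type*} [AddCommGroup M] (g : ℕ → C →+ M) (a b : C) : M :=
  (nprods (k := k) a b).sum fun s c => g s c

theorem sumProd_eq {M : Type*} [AddCommGroup M] (g : ℕ → C →+ M) (a b : C) (N : ℕ)
    (hN : ∀ n, N ≤ n → nprod (k := k) n a b = 0) :
    sumProd (k := k) g a b = ∑ s ∈ Finset.range N, g s (nprod (k := k) s a b) := by
  refine Finsupp.sum_of_support_subset _ (fun n hn => ?_) _ (by simp)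
  rw [Finset.mem_range]
  by_contra h
  exact (Finsupp.mem_support_iff.mp hn) (hN n (not_lt.mp h))

theorem sumProd_add_left {M : Type*} [AddCommGroup M] (g : ℕ → C →+ M) (a a' b : C) :
    sumProd (k := k) g (a + a') b = sumProd (k := k) g a b + sumProd (k := k) g a' b := by
  rw [sumProd, map_add, LinearMap.add_apply]
  exact Finsupp.sum_add_index' (by simp) (by simp)

theorem sumProd_add_right {M : Type*} [AddCommGroup M] (g : ℕ → C →+ M) (a b b' : C) :
    sumProd (k := k) g a (b + b') = sumProd (k := k) g a b + sumProd (k := k) g a b' := by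
  rw [sumProd, map_add]
  exact Finsupp.sum_add_index' (by simp) (by simp)

theorem sumProd_add {M : Type*} [AddCommGroup M] (g g' : ℕ → C →+ M) (a b : C) :
    sumProd (k := k) (fun s => g s + g' s) a b =
      sumProd (k := k) g a b + sumProd (k := k) g' a b := by
  simp only [sumProd, AddMonoidHom.add_apply]
  exact Finsupp.sum_add

theorem sumProd_smul_left {M : Type*} [AddCommGroup M] (g : ℕ → C →+ M) (c : k) (a b : C) :
    sumProd (k := k) g (c • a) b =
      sumProd (k := k) (fun s => (g s).comp (DistribSMul.toAddMonoidHom C c)) a b := by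
  rw [sumProd, map_smul, LinearMap.smul_apply]
  exact Finsupp.sum_smul_index' (by simp)

theorem sumProd_smul_right {M : Type*} [AddCommGroup M] (g : ℕ → C →+ M) (c : k) (a b : C) :
    sumProd (k := k) g a (c • b) =
      sumProd (k := k) (fun s => (g s).comp (DistribSMul.toAddMonoidHom C c)) a b := by
  rw [sumProd, map_smul]
  exact Finsupp.sum_smul_index' (by simp)

/-- Left sesqui-linearity, in terms of `sumProd`. -/
theorem sumProd_D_left {M : Type*} [AddCommGroup M] (g : ℕ → C →+ M) (a b : C) :
    sumProd (k := k) g ((X : k[X]) • a) b =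
      sumProd (k := k)
        (fun s => -(g (s + 1)).comp (DistribSMul.toAddMonoidHom C ((s + 1 : ℕ) : k))) a b := by
  obtain ⟨N, hN⟩ := locality (k := k) a b
  rw [sumProd_eq g _ b (N + 1), sumProd_eq _ a b N hN, Finset.sum_range_succ']
  · simp [nprod_D_left]
  · intro n hn
    rw [nprod_D_left, hN (n - 1) (by omega), smul_zero, neg_zero]

/-- Right sesqui-linearity, in terms of `sumProd`. -/
theorem sumProd_D_right {M : Type*} [AddCommGroup M] (g : ℕ → C →+ M) (a b : C) :
    sumProd (k := k) g a ((X : k[X]) • b) =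
      sumProd (k := k)
        (fun s => (g s).comp (DistribSMul.toAddMonoidHom C (X : k[X])) +
          (g (s + 1)).comp (DistribSMul.toAddMonoidHom C ((s + 1 : ℕ) : k))) a b := by
  obtain ⟨N, hN⟩ := locality (k := k) a b
  rw [sumProd_eq g a _ (N + 1), sumProd_eq _ a b N hN]
  · simp only [nprod_D_right, map_add, Finset.sum_add_distrib, AddMonoidHom.add_apply]
    congr 1
    · rw [Finset.sum_range_succ, hN N le_rfl]
      simp
    · rw [Finset.sum_range_succ']
      simp
  · intro n hn
    rw [nprod_D_right, hN (n - 1) (by omega), hN n (by omega), smul_zero, smul_zero, add_zero]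

theorem sumProd_congr {M : Type*} [AddCommGroup M] {g g' : ℕ → C →+ M} (h : ∀ s c, g s c = g' s c)
    (a b : C) : sumProd (k := k) g a b = sumProd (k := k) g' a b := by
  have : g = g' := funext fun s => AddMonoidHom.ext (h s)
  rw [this]

/-! ### A conformal algebra as a pseudoalgebra -/

/-- The map `c ↦ ((-D)^s / s! ⊗ 1) ⊗_H c`. -/
def pterm (k C : Type*) [Field k] [AddCommGroup C] [Module k[X] C] (s : ℕ) :
    C →+ HTensor k 2 C :=
  (TensorProduct.mk k[X] (TPow k 2) C
    (TPow.pure ![Polynomial.C ((s.factorial : k)⁻¹) * (-X) ^ s, 1])).toAddMonoidHom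

theorem pterm_apply (s : ℕ) (c : C) : pterm k C s c =
    TPow.pure ![Polynomial.C ((s.factorial : k)⁻¹) * (-X) ^ s, 1] ⊗ₜ[k[X]] c := rfl

theorem sumProd_map {M N : Type*} [AddCommGroup M] [AddCommGroup N] (φ : M →+ N)
    (g : ℕ → C →+ M) (a b : C) :
    φ (sumProd (k := k) g a b) = sumProd (k := k) (fun s => φ.comp (g s)) a b := by
  simp only [sumProd, Finsupp.sum, map_sum, AddMonoidHom.comp_apply]

/-- The pseudoproduct `a * b = ∑ s, ((-D)^s / s! ⊗ 1) ⊗_H (a ₛ b)`. -/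
def pseudoprod : C →ₗ[k] C →ₗ[k] HTensor k 2 C :=
  LinearMap.mk₂ k (fun a b => sumProd (k := k) (pterm k C) a b)
    (sumProd_add_left _)
    (fun c a b => by
      rw [sumProd_smul_left, ← DistribSMul.toAddMonoidHom_apply _ c (sumProd _ _ _), sumProd_map]
      refine sumProd_congr (fun s x => ?_) a b
      simp [pterm_apply, TensorProduct.tmul_smul])
    (fun a b b' => sumProd_add_right _ a b b')
    (fun c a b => by
      rw [sumProd_smul_right, ← DistribSMul.toAddMonoidHom_apply _ c (sumProd _ _ _), sumProd_map]
      refine sumProd_congr (fun s x => ?_) a b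
      simp [pterm_apply, TensorProduct.tmul_smul])

theorem pseudoprod_apply (a b : C) : pseudoprod (k := k) a b =
    (nprods (k := k) a b).sum fun s c =>
      TPow.pure ![Polynomial.C ((s.factorial : k)⁻¹) * (-X) ^ s, 1] ⊗ₜ[k[X]] c := rfl

theorem smul_sumProd {n : ℕ} (F : TPow k n) (g : ℕ → C →+ HTensor k n C) (a b : C) :
    F • sumProd (k := k) g a b =
      sumProd (k := k) (fun s => (DistribSMul.toAddMonoidHom (HTensor k n C) F).comp (g s)) a b :=
  sumProd_map (DistribSMul.toAddMonoidHom (HTensor k n C) F) g a b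

theorem inv_factorial_succ [CharZero k] (s : ℕ) :
    (((s + 1).factorial : k)⁻¹) * ((s : k) + 1) = ((s.factorial : k)⁻¹) := by
  have h : (s : k) + 1 ≠ 0 := Nat.cast_add_one_ne_zero s
  have h' : (s.factorial : k) ≠ 0 := Nat.cast_ne_zero.mpr s.factorial_ne_zero
  rw [Nat.factorial_succ]
  push_cast
  field_simp

theorem pterm_eq (s : ℕ) (c : C) : pterm k C s c =
    (TPow.single 0 (Polynomial.C ((s.factorial : k)⁻¹) * (-X) ^ s) : TPow k 2) ⊗ₜ[k[X]] c := by
  rw [pterm_apply, ← TPow.prod_single, Fin.prod_univ_two]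
  simp

theorem pterm_succ_left [CharZero k] (s : ℕ) (c : C) :
    -pterm k C (s + 1) (((s + 1 : ℕ) : k) • c) = (TPow.single 0 X : TPow k 2) • pterm k C s c := by
  rw [pterm_eq, pterm_eq, TensorProduct.tmul_smul, TensorProduct.smul_tmul',
    TensorProduct.smul_tmul', smul_eq_mul, ← map_mul, ← TensorProduct.neg_tmul, ← map_smul,
    ← map_neg, ← inv_factorial_succ (k := k) s, Polynomial.smul_eq_C_mul]
  congr 2
  push_cast
  simp only [map_add, map_one, map_mul]
  ring

theorem pterm_D [CharZero k] (s : ℕ) (c : C) :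
    pterm k C s ((X : k[X]) • c) =
      (TPow.single 0 X : TPow k 2) • pterm k C s c +
      (TPow.single 1 X : TPow k 2) • pterm k C s c := by
  rw [← add_smul, pterm_apply, pterm_apply, ← TensorProduct.smul_tmul, TPow.smul_eq,
    TPow.coprod_X, Fin.sum_univ_two, TensorProduct.smul_tmul', smul_eq_mul]

theorem pseudoprod_D_left [CharZero k] (a b : C) : pseudoprod (k := k) ((X : k[X]) • a) b =
    (TPow.single 0 X : TPow k 2) • pseudoprod (k := k) a b := by
  change sumProd _ _ _ = _ • sumProd _ _ _
  rw [sumProd_D_left, smul_sumProd]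
  exact sumProd_congr (fun s x => pterm_succ_left s x) a b

theorem pseudoprod_D_right [CharZero k] (a b : C) : pseudoprod (k := k) a ((X : k[X]) • b) =
    (TPow.single 1 X : TPow k 2) • pseudoprod (k := k) a b := by
  change sumProd _ _ _ = _ • sumProd _ _ _
  rw [sumProd_D_right, smul_sumProd]
  refine sumProd_congr (fun s x => ?_) a b
  have h1 := pterm_succ_left (k := k) s x
  have h2 := pterm_D (k := k) s x
  rw [← h1] at h2
  change pterm k C s ((X : k[X]) • x) + pterm k C (s + 1) (((s + 1 : ℕ) : k) • x) = _
  rw [h2]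
  simp

theorem pseudoprod_smul_left [CharZero k] (f : k[X]) (a b : C) : pseudoprod (k := k) (f • a) b =
    (TPow.single 0 f : TPow k 2) • pseudoprod (k := k) a b := by
  revert a
  refine poly_induct (p := fun f => ∀ a, pseudoprod (k := k) (f • a) b =
    (TPow.single 0 f : TPow k 2) • pseudoprod (k := k) a b) (fun c a => ?_)
    (fun a => pseudoprod_D_left a b) (fun p q hp hq a => ?_) (fun p q hp hq a => ?_) f
  · rw [Polynomial.C_eq_algebraMap, algebraMap_smul, AlgHom.commutes, algebraMap_smul, map_smul,
      LinearMap.smul_apply]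
  · simp only [add_smul, map_add, LinearMap.add_apply, hp, hq]
  · rw [mul_smul, hp, hq, map_mul, mul_smul]

theorem pseudoprod_smul_right [CharZero k] (f : k[X]) (a b : C) : pseudoprod (k := k) a (f • b) =
    (TPow.single 1 f : TPow k 2) • pseudoprod (k := k) a b := by
  revert b
  refine poly_induct (p := fun f => ∀ b, pseudoprod (k := k) a (f • b) =
    (TPow.single 1 f : TPow k 2) • pseudoprod (k := k) a b) (fun c b => ?_)
    (fun b => pseudoprod_D_right a b) (fun p q hp hq b => ?_) (fun p q hp hq b => ?_) f
  · rw [Polynomial.C_eq_algebraMap, algebraMap_smul, AlgHom.commutes, algebraMap_smul, map_smul]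
  · simp only [add_smul, map_add, hp, hq]
  · rw [mul_smul, hp, hq, map_mul, mul_smul]

/-- A conformal algebra, viewed as an `H`-pseudoalgebra. -/
instance toPseudoalgebra [CharZero k] : Pseudoalgebra k C where
  pprod := pseudoprod
  smul_pprod_smul f g a b := by
    rw [pseudoprod_smul_left, pseudoprod_smul_right, smul_smul, ← TPow.prod_single,
      Fin.prod_univ_two]
    rfl

end ConformalAlgebra

/-! ## The coefficient algebra -/

/-- The linear endomorphism of `k[t, t⁻¹]` with prescribed values on the powers `t^n`. -/
def laurentLin {k : Type*} [Field k] (v : ℤ → k[T;T⁻¹]) : k[T;T⁻¹] →ₗ[k] k[T;T⁻¹] :=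
  (AddMonoidAlgebra.basis ℤ k).constr k v

theorem laurentLin_T {k : Type*} [Field k] (v : ℤ → k[T;T⁻¹]) (n : ℤ) :
    laurentLin v (T n) = v n :=
  (AddMonoidAlgebra.basis ℤ k).constr_basis k v n

theorem laurent_ext {k M : Type*} [Field k] [AddCommGroup M] [Module k M]
    {f g : k[T;T⁻¹] →ₗ[k] M} (h : ∀ n : ℤ, f (T n) = g (T n)) : f = g :=
  (AddMonoidAlgebra.basis ℤ k).ext h

/-- The map `t^n ↦ binom(n, s) t^{n-s}`, `n ∈ ℤ`. -/
def laurentHasse (k : Type*) [Field k] (s : ℕ) : k[T;T⁻¹] →ₗ[k] k[T;T⁻¹] :=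
  laurentLin fun n => ((Ring.choose n s : ℤ) : k) • T (n - s)

/-- The map `t^n ↦ -n t^{n-1}`, `n ∈ ℤ`. -/
def laurentD (k : Type*) [Field k] : k[T;T⁻¹] →ₗ[k] k[T;T⁻¹] :=
  laurentLin fun n => -((n : k) • T (n - 1))

/-- The space `k[t, t⁻¹]` as an `H`-module, with `D` acting by `t^n ↦ -n t^{n-1}`. -/
abbrev LaurentH (k : Type*) [Field k] : Type _ := Module.AEval' (laurentD k)

theorem laurentHasse_D {k : Type*} [Field k] (s : ℕ) (x : k[T;T⁻¹]) :
    laurentHasse k s (laurentD k x) = -(((s + 1 : ℕ) : k) • laurentHasse k (s + 1) x) := by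
  have h : laurentHasse k s ∘ₗ laurentD k = -(((s + 1 : ℕ) : k) • laurentHasse k (s + 1)) := by
    refine laurent_ext fun n => ?_
    have e := Ring.choose_smul_choose n (n := s + 1) (k := 1) (by omega)
    have e' : ((s + 1 : ℕ) : k) * ((Ring.choose n (s + 1) : ℤ) : k) =
        (n : k) * ((Ring.choose (n - 1) s : ℤ) : k) := by
      simp at e
      have e2 := congrArg (Int.cast : ℤ → k) e
      push_cast at e2 ⊢
      exact e2
    simp only [LinearMap.comp_apply, laurentD, laurentHasse, laurentLin_T, map_neg, map_smul,
      LinearMap.neg_apply, LinearMap.smul_apply, smul_smul, e']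
    congr 3
    push_cast
    ring
  exact LinearMap.congr_fun h x

theorem laurentD_hasse {k : Type*} [Field k] (s : ℕ) (x : k[T;T⁻¹]) :
    laurentD k (laurentHasse k s x) = -(((s + 1 : ℕ) : k) • laurentHasse k (s + 1) x) := by
  have h : laurentD k ∘ₗ laurentHasse k s = -(((s + 1 : ℕ) : k) • laurentHasse k (s + 1)) := by
    refine laurent_ext fun n => ?_
    have e := Ring.choose_smul_choose n (n := s + 1) (k := s) (by omega)
    have e' : ((s + 1 : ℕ) : k) * ((Ring.choose n (s + 1) : ℤ) : k) =
        ((Ring.choose n s : ℤ) : k) * (((n - s : ℤ)) : k) := by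
      simp at e
      have e2 := congrArg (Int.cast : ℤ → k) e
      push_cast at e2 ⊢
      exact e2
    simp only [LinearMap.comp_apply, laurentD, laurentHasse, laurentLin_T, map_smul,
      LinearMap.neg_apply, LinearMap.smul_apply, smul_smul, smul_neg, e']
    congr 3
    push_cast
    ring
  exact LinearMap.congr_fun h x

theorem laurentD_mul {k : Type*} [Field k] (x y : k[T;T⁻¹]) :
    laurentD k (x * y) = laurentD k x * y + x * laurentD k y := by
  have h : (LinearMap.mul k k[T;T⁻¹]).compr₂ (laurentD k) =
      (LinearMap.mul k k[T;T⁻¹]).comp (laurentD k) +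
        (LinearMap.mul k k[T;T⁻¹]).compl₂ (laurentD k) := by
    refine laurent_ext fun n => laurent_ext fun m => ?_
    simp only [LinearMap.compr₂_apply, LinearMap.mul_apply', LinearMap.add_apply,
      LinearMap.comp_apply, LinearMap.compl₂_apply, ← T_add, laurentD, laurentLin_T]
    simp only [neg_mul, mul_neg, smul_mul_assoc, mul_smul_comm, ← T_add, ← neg_add]
    rw [show n - 1 + m = n + m - 1 by ring, show n + (m - 1) = n + m - 1 by ring, ← add_smul]
    push_cast
    rfl
  exact LinearMap.congr_fun (LinearMap.congr_fun h x) y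

/-- The underlying space `k[t, t⁻¹] ⊗_H C` of the coefficient algebra of a conformal algebra. -/
def Coeff (k C : Type*) [Field k] [AddCommGroup C] [Module k[X] C] : Type _ :=
  LaurentH k ⊗[k[X]] C

namespace Coeff

variable {k C : Type*} [Field k] [AddCommGroup C] [Module k[X] C]

instance instAddCommGroup : AddCommGroup (Coeff k C) :=
  inferInstanceAs (AddCommGroup (LaurentH k ⊗[k[X]] C))

instance instModule : Module k (Coeff k C) :=
  inferInstanceAs (Module k (LaurentH k ⊗[k[X]] C))

/-- The element `a(x) = x ⊗_H a`. -/
def mk (x : k[T;T⁻¹]) (a : C) : Coeff k C :=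
  (Module.AEval'.of (laurentD k) x) ⊗ₜ[k[X]] a

theorem mk_add_left (x y : k[T;T⁻¹]) (a : C) : mk (x + y) a = mk x a + mk y a := by
  simp only [mk, map_add, TensorProduct.add_tmul]
  rfl

theorem mk_add_right (x : k[T;T⁻¹]) (a b : C) : mk x (a + b) = mk x a + mk x b := by
  simp only [mk, TensorProduct.tmul_add]
  rfl

theorem mk_D (x : k[T;T⁻¹]) (a : C) : mk (laurentD k x) a = mk x ((X : k[X]) • a) := by
  rw [mk, mk, ← Module.AEval'.X_smul_of, TensorProduct.smul_tmul]

theorem mk_smul (c : k) (x : k[T;T⁻¹]) (a : C) : mk (c • x) a = c • mk x a := rfl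

theorem hom_ext {M : Type*} [AddCommGroup M] {f g : Coeff k C →+ M}
    (h : ∀ x a, f (mk x a) = g (mk x a)) : f = g :=
  addHom_ext_tmul (fun x a => h ((Module.AEval'.of (laurentD k)).symm x) a)

variable [Module k C] [IsScalarTower k k[X] C]

theorem mk_smul_right (c : k) (x : k[T;T⁻¹]) (a : C) : mk x (c • a) = c • mk x a := by
  rw [← algebraMap_smul k[X], mk, ← TensorProduct.smul_tmul, algebraMap_smul]
  rfl

/-- The map `a ↦ a(x)`. -/
def mkHom (C : Type*) [AddCommGroup C] [Module k[X] C] (x : k[T;T⁻¹]) : C →+ Coeff k C :=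
  AddMonoidHom.mk' (mk x) (mk_add_right x)

variable [ConformalAlgebra k C]

open ConformalAlgebra

/-- The product `a(x) b(y)`, i.e. the finite sum `∑ s, (a ₛ b)(x^{[s]} y)` where
`x ↦ x^{[s]}` is the linear map `t^n ↦ binom(n, s) t^{n-s}`. -/
def preMul (x : k[T;T⁻¹]) (a : C) (y : k[T;T⁻¹]) (b : C) : Coeff k C :=
  sumProd (k := k) (fun s => mkHom C (laurentHasse k s x * y)) a b

theorem preMul_add₁ (x x' : k[T;T⁻¹]) (a : C) (y : k[T;T⁻¹]) (b : C) :
    preMul (x + x') a y b = preMul x a y b + preMul x' a y b := by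
  rw [preMul, preMul, preMul, ← sumProd_add]
  refine sumProd_congr (fun s c => ?_) a b
  simp [mkHom, add_mul, mk_add_left]

theorem preMul_add₂ (x : k[T;T⁻¹]) (a a' : C) (y : k[T;T⁻¹]) (b : C) :
    preMul x (a + a') y b = preMul x a y b + preMul x a' y b :=
  sumProd_add_left _ a a' b

theorem preMul_add₃ (x : k[T;T⁻¹]) (a : C) (y y' : k[T;T⁻¹]) (b : C) :
    preMul x a (y + y') b = preMul x a y b + preMul x a y' b := by
  rw [preMul, preMul, preMul, ← sumProd_add]
  refine sumProd_congr (fun s c => ?_) a b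
  simp [mkHom, mul_add, mk_add_left]

theorem preMul_add₄ (x : k[T;T⁻¹]) (a : C) (y : k[T;T⁻¹]) (b b' : C) :
    preMul x a y (b + b') = preMul x a y b + preMul x a y b' :=
  sumProd_add_right _ a b b'

theorem preMul_smul₁ (c : k) (x : k[T;T⁻¹]) (a : C) (y : k[T;T⁻¹]) (b : C) :
    preMul (c • x) a y b = c • preMul x a y b := by
  rw [preMul, preMul, ← DistribSMul.toAddMonoidHom_apply _ c (sumProd _ _ _), sumProd_map]
  refine sumProd_congr (fun s d => ?_) a b
  simp [mkHom, mk_smul]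

theorem preMul_smul₂ (c : k) (x : k[T;T⁻¹]) (a : C) (y : k[T;T⁻¹]) (b : C) :
    preMul x (c • a) y b = c • preMul x a y b := by
  rw [preMul, preMul, sumProd_smul_left, ← DistribSMul.toAddMonoidHom_apply _ c (sumProd _ _ _),
    sumProd_map]
  refine sumProd_congr (fun s d => ?_) a b
  simp [mkHom, mk_smul_right]

theorem preMul_smul₃ (c : k) (x : k[T;T⁻¹]) (a : C) (y : k[T;T⁻¹]) (b : C) :
    preMul x a (c • y) b = c • preMul x a y b := by
  rw [preMul, preMul, ← DistribSMul.toAddMonoidHom_apply _ c (sumProd _ _ _), sumProd_map]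
  refine sumProd_congr (fun s d => ?_) a b
  simp [mkHom, mk_smul]

theorem preMul_smul₄ (c : k) (x : k[T;T⁻¹]) (a : C) (y : k[T;T⁻¹]) (b : C) :
    preMul x a y (c • b) = c • preMul x a y b := by
  rw [preMul, preMul, sumProd_smul_right, ← DistribSMul.toAddMonoidHom_apply _ c (sumProd _ _ _),
    sumProd_map]
  refine sumProd_congr (fun s d => ?_) a b
  simp [mkHom, mk_smul_right]

theorem preMul_D_left (x : k[T;T⁻¹]) (a : C) (y : k[T;T⁻¹]) (b : C) :
    preMul (laurentD k x) a y b = preMul x ((X : k[X]) • a) y b := by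
  rw [preMul, preMul, sumProd_D_left]
  refine sumProd_congr (fun s c => ?_) a b
  simp only [mkHom, laurentHasse_D, AddMonoidHom.mk'_apply, AddMonoidHom.neg_apply,
    AddMonoidHom.comp_apply, DistribSMul.toAddMonoidHom_apply, mk_smul_right, ← mk_smul]
  rw [neg_mul, smul_mul_assoc, ← neg_one_smul k, mk_smul, neg_one_smul]

theorem preMul_D_right (x : k[T;T⁻¹]) (a : C) (y : k[T;T⁻¹]) (b : C) :
    preMul x a (laurentD k y) b = preMul x a y ((X : k[X]) • b) := by
  rw [preMul, preMul, sumProd_D_right]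
  refine sumProd_congr (fun s c => ?_) a b
  simp only [mkHom, AddMonoidHom.mk'_apply, AddMonoidHom.add_apply,
    AddMonoidHom.comp_apply, DistribSMul.toAddMonoidHom_apply, mk_smul_right, ← mk_smul, ← mk_D]
  rw [laurentD_mul, laurentD_hasse, ← mk_add_left]
  congr 1
  rw [neg_mul, smul_mul_assoc]
  abel

/-- `preMul` with its first argument in the `H`-module `k[t, t⁻¹]`. -/
theorem preMul_balanced_left (h : k[X]) (x : LaurentH k) (a : C) (y : k[T;T⁻¹]) (b : C) :
    preMul ((Module.AEval'.of (laurentD k)).symm (h • x)) a y b =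
      preMul ((Module.AEval'.of (laurentD k)).symm x) (h • a) y b := by
  revert x a
  refine poly_induct (p := fun h => ∀ (x : LaurentH k) (a : C),
    preMul ((Module.AEval'.of (laurentD k)).symm (h • x)) a y b =
      preMul ((Module.AEval'.of (laurentD k)).symm x) (h • a) y b)
    (fun c x a => ?_) (fun x a => ?_) (fun p q hp hq x a => ?_) (fun p q hp hq x a => ?_) h
  · rw [Polynomial.C_eq_algebraMap, algebraMap_smul, algebraMap_smul, map_smul, preMul_smul₁,
      preMul_smul₂]
  · rw [← preMul_D_left, Module.AEval.of_symm_X_smul]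
    rfl
  · rw [add_smul, add_smul, map_add, preMul_add₁, preMul_add₂, hp, hq]
  · rw [mul_smul, hp, hq, ← mul_smul, mul_comm]

theorem preMul_balanced_right (h : k[X]) (x : k[T;T⁻¹]) (a : C) (y : LaurentH k) (b : C) :
    preMul x a ((Module.AEval'.of (laurentD k)).symm (h • y)) b =
      preMul x a ((Module.AEval'.of (laurentD k)).symm y) (h • b) := by
  revert y b
  refine poly_induct (p := fun h => ∀ (y : LaurentH k) (b : C),
    preMul x a ((Module.AEval'.of (laurentD k)).symm (h • y)) b =
      preMul x a ((Module.AEval'.of (laurentD k)).symm y) (h • b))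
    (fun c y b => ?_) (fun y b => ?_) (fun p q hp hq y b => ?_) (fun p q hp hq y b => ?_) h
  · rw [Polynomial.C_eq_algebraMap, algebraMap_smul, algebraMap_smul, map_smul, preMul_smul₃,
      preMul_smul₄]
  · rw [← preMul_D_right, Module.AEval.of_symm_X_smul]
    rfl
  · rw [add_smul, add_smul, map_add, preMul_add₃, preMul_add₄, hp, hq]
  · rw [mul_smul, hp, hq, ← mul_smul, mul_comm]

/-- The map `v ↦ a(x) v`. -/
def mulRight (x : k[T;T⁻¹]) (a : C) : Coeff k C →+ Coeff k C :=
  TensorProduct.liftAddHom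
    (biAdd (fun (y : LaurentH k) (b : C) =>
        preMul x a ((Module.AEval'.of (laurentD k)).symm y) b)
      (fun y y' b => by rw [map_add, preMul_add₃])
      (fun y b b' => preMul_add₄ _ _ _ _ _))
    (fun h y b => preMul_balanced_right h x a y b)

theorem mulRight_mk (x : k[T;T⁻¹]) (a : C) (y : k[T;T⁻¹]) (b : C) :
    mulRight x a (mk y b) = preMul x a y b := rfl

/-- The multiplication of the coefficient algebra. -/
def mulHom : Coeff k C →+ Coeff k C →+ Coeff k C :=
  TensorProduct.liftAddHom
    (biAdd (fun (x : LaurentH k) (a : C) =>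
        mulRight ((Module.AEval'.of (laurentD k)).symm x) a)
      (fun x x' a => hom_ext fun y b => by
        rw [AddMonoidHom.add_apply, mulRight_mk, mulRight_mk, mulRight_mk, map_add, preMul_add₁])
      (fun x a a' => hom_ext fun y b => by
        rw [AddMonoidHom.add_apply, mulRight_mk, mulRight_mk, mulRight_mk, preMul_add₂]))
    (fun h x a => hom_ext fun y b => preMul_balanced_left h x a y b)

/-- The coefficient algebra, a not necessarily associative algebra. -/
instance instNonUnitalNonAssocRing : NonUnitalNonAssocRing (Coeff k C) where
  mul u v := mulHom u v
  left_distrib u v w := map_add (mulHom u) v w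
  right_distrib u v w := by
    change mulHom (u + v) w = mulHom u w + mulHom v w
    rw [map_add, AddMonoidHom.add_apply]
  zero_mul u := by
    change mulHom 0 u = 0
    rw [map_zero, AddMonoidHom.zero_apply]
  mul_zero u := map_zero (mulHom u)

theorem mk_mul_mk (x : k[T;T⁻¹]) (a : C) (y : k[T;T⁻¹]) (b : C) :
    (mk x a * mk y b : Coeff k C) = preMul x a y b := rfl

/-- `a(n) b(m) = ∑ s, binom(n, s) (a ₛ b)(n + m - s)`. -/
theorem mk_T_mul_mk_T (n m : ℤ) (a b : C) :
    (mk (T n) a * mk (T m) b : Coeff k C) =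
      (nprods (k := k) a b).sum fun s c =>
        ((Ring.choose n s : ℤ) : k) • (mk (T (n + m - s)) c : Coeff k C) := by
  rw [mk_mul_mk]
  refine Finsupp.sum_congr fun s _ => ?_
  change mk (laurentHasse k s (T n) * T m) _ = _
  rw [laurentHasse, laurentLin_T, smul_mul_assoc, ← T_add, mk_smul]
  congr 3
  ring

instance instIsScalarTower : IsScalarTower k (Coeff k C) (Coeff k C) where
  smul_assoc c u v := by
    have h : (AddMonoidHom.mul (R := Coeff k C)).comp
        (DistribSMul.toAddMonoidHom (Coeff k C) c) =
        (AddMonoidHom.compHom (DistribSMul.toAddMonoidHom (Coeff k C) c)).comp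
          AddMonoidHom.mul := by
      refine hom_ext fun x a => hom_ext fun y b => ?_
      change c • mk x a * mk y b = c • (mk x a * mk y b)
      rw [← mk_smul, mk_mul_mk, preMul_smul₁, mk_mul_mk]
    exact DFunLike.congr_fun (DFunLike.congr_fun h u) v

instance instSMulCommClass : SMulCommClass k (Coeff k C) (Coeff k C) where
  smul_comm c u v := by
    have h : (AddMonoidHom.compHom (DistribSMul.toAddMonoidHom (Coeff k C) c)).comp
          AddMonoidHom.mul = AddMonoidHom.compl₂ (AddMonoidHom.mul (R := Coeff k C))
        (DistribSMul.toAddMonoidHom (Coeff k C) c) := by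
      refine hom_ext fun x a => hom_ext fun y b => ?_
      change c • (mk x a * mk y b) = mk x a * c • mk y b
      rw [← mk_smul, mk_mul_mk, mk_mul_mk, preMul_smul₃]
    exact DFunLike.congr_fun (DFunLike.congr_fun h u) v

end Coeff

/-! ## Multilinear identities and pseudo-identities -/

/-- The bracketings of a word of `n` letters. -/
inductive Bracketing : ℕ → Type
  | leaf : Bracketing 1
  | node {n m : ℕ} (u : Bracketing n) (v : Bracketing m) : Bracketing (n + m)

namespace Bracketing

/-- The product of `b₁, …, bₙ`, in this order, with the given bracketing. -/
def eval {A : Type*} [Mul A] : {n : ℕ} → Bracketing n → (Fin n → A) → A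
  | _, leaf, b => b 0
  | _, node (n := n) (m := m) u v, b =>
    u.eval (fun i => b (Fin.castAdd m i)) * v.eval (fun j => b (Fin.natAdd n j))

/-- The same expression with all products replaced by (expanded) pseudoproducts; a letter `b`
is read as `1 ⊗_H b`. -/
def pseudoEval {k P : Type*} [Field k] [AddCommGroup P] [Module k P] [Module k[X] P]
    [IsScalarTower k k[X] P] [Pseudoalgebra k P] :
    {n : ℕ} → Bracketing n → (Fin n → P) → HTensor k n P
  | _, leaf, b => (1 : TPow k 1) ⊗ₜ[k[X]] b 0
  | _, node (n := n) (m := m) u v, b =>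
    Pseudoalgebra.expanded (u.pseudoEval (k := k) (fun i => b (Fin.castAdd m i)))
      (v.pseudoEval (k := k) (fun j => b (Fin.natAdd n j)))

end Bracketing

/-- A homogeneous multilinear non-associative polynomial
`f(a₁, …, aₙ) = ∑ σ, t_σ(a_{σ 1}, …, a_{σ n})`, where `t_σ(b₁, …, bₙ)` is a linear combination
of bracketings of the word `b₁ ⋯ bₙ`. -/
abbrev MultilinearPoly (k : Type*) [Field k] (n : ℕ) : Type _ :=
  Equiv.Perm (Fin n) → (Bracketing n →₀ k)

namespace MultilinearPoly

variable {k : Type*} [Field k] {n : ℕ}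

/-- `f(a₁, …, aₙ)` in a non-associative algebra. -/
def eval {A : Type*} [NonUnitalNonAssocRing A] [Module k A] (f : MultilinearPoly k n)
    (a : Fin n → A) : A :=
  ∑ σ : Equiv.Perm (Fin n), (f σ).sum fun w c => c • w.eval (fun i => a (σ i))

/-- `σ ⊗_H id : H^{⊗ n} ⊗_H P → H^{⊗ n} ⊗_H P`. -/
def permTensor (P : Type*) [AddCommGroup P] [Module k[X] P] (σ : Equiv.Perm (Fin n)) :
    HTensor k n P →ₗ[k[X]] HTensor k n P :=
  LinearMap.rTensor P (TPow.toHLinear (TPow.perm σ) (TPow.perm_coprod σ))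

/-- `f^*(a₁, …, aₙ) = ∑ σ, (σ ⊗_H id) t_σ^*(a_{σ 1}, …, a_{σ n})` in a pseudoalgebra. -/
def pseudoEval {P : Type*} [AddCommGroup P] [Module k P] [Module k[X] P]
    [IsScalarTower k k[X] P] [Pseudoalgebra k P] (f : MultilinearPoly k n) (a : Fin n → P) :
    HTensor k n P :=
  ∑ σ : Equiv.Perm (Fin n), permTensor P σ
    ((f σ).sum fun w c => c • w.pseudoEval (k := k) (fun i => a (σ i)))

end MultilinearPoly

/-- The algebra `A` satisfies the identity `f = 0`. -/
def SatisfiesIdentity {k : Type*} [Field k] {n : ℕ} (A : Type*) [NonUnitalNonAssocRing A]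
    [Module k A] (f : MultilinearPoly k n) : Prop :=
  ∀ a : Fin n → A, f.eval a = 0

/-- The pseudoalgebra `P` satisfies the pseudo-identity `f^* = 0`. -/
def SatisfiesPseudoIdentity {k : Type*} [Field k] {n : ℕ} (P : Type*) [AddCommGroup P]
    [Module k P] [Module k[X] P] [IsScalarTower k k[X] P] [Pseudoalgebra k P]
    (f : MultilinearPoly k n) : Prop :=
  ∀ a : Fin n → P, f.pseudoEval a = 0

end

/-! A tuple x = (x₁, …, xₙ) of Laurent polynomials gives a map H^{⊗n} ⊗_H C → Coeff C
(`Coeff.evalTensor`): let the i-th tensor factor act on xᵢ, multiply the results, and tensor with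
the element of C. It is well defined over H because D acts on k[t, t⁻¹] by a derivation, so that
Δ^{(n)}(D) acts on the factors exactly as D acts on their product (`TPow.act_smul`).

These maps turn expanded pseudoproducts into products of Coeff C (`Coeff.evalTensor_expanded`):
(-D)^s/s! sends t^m to binom(m, s) t^{m-s}, which is the coefficient in the product a(m) b(l). Hence
f^*(a₁, …, aₙ) is sent to f(a₁(x₁), …, aₙ(xₙ)), which is 0 for every x by hypothesis.

It remains to see that the maps jointly separate points (`HTensor.eq_zero_of_evalTensor_eq_zero`).
With n + 1 factors, every tensor is a finite sum of (D^{α₁} ⊗ ⋯ ⊗ D^{αₙ} ⊗ 1) ⊗_H c_α. Evaluate it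
at (t^{β₁}, …, t^{βₙ}, t⁻¹) and then apply the map Coeff C → C induced by the H-linear projection of
k[t, t⁻¹] onto H t⁻¹ ≅ H along k[t]. The term α dies if some αᵢ > βᵢ, since D^{αᵢ} t^{βᵢ} = 0; it
also dies if α ≤ β and α ≠ β, since a nonnegative power of t is left. Only α = β survives, with
coefficient ∏ (-1)^{βᵢ} βᵢ!, which is nonzero in characteristic 0. So every c_β is 0. -/

namespace TPow

variable {k : Type*} [Field k]

/-! ### The action of H^{⊗n} on tuples of Laurent polynomials -/

theorem induction_pure {n : ℕ} {p : TPow k n → Prop} (F : TPow k n)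
    (hpure : ∀ (c : k) (f : Fin n → k[X]), p (c • pure f))
    (hadd : ∀ F G, p F → p G → p (F + G)) : p F :=
  PiTensorProduct.induction_on (motive := p) F hpure hadd

/-- The action of `H^{⊗ n}` on a tuple `x` of Laurent polynomials, followed by multiplication:
`f₁ ⊗ ⋯ ⊗ fₙ ↦ (f₁ x₁) ⋯ (fₙ xₙ)`, where `D` acts by `laurentD`. -/
noncomputable def act {n : ℕ} (x : Fin n → k[T;T⁻¹]) : TPow k n →ₗ[k] k[T;T⁻¹] :=
  PiTensorProduct.lift ((MultilinearMap.mkPiAlgebra k (Fin n) k[T;T⁻¹]).compLinearMap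
    fun i => (LinearMap.applyₗ (R := k) (x i)).comp (aeval (laurentD k)).toLinearMap)

theorem act_pure {n : ℕ} (x : Fin n → k[T;T⁻¹]) (f : Fin n → k[X]) :
    act x (pure f) = ∏ i, aeval (laurentD k) (f i) (x i) := by
  simp only [act, pure]
  erw [PiTensorProduct.lift.tprod]
  simp

theorem laurentD_prod {ι : Type*} [DecidableEq ι] (s : Finset ι) (y : ι → k[T;T⁻¹]) :
    laurentD k (∏ i ∈ s, y i) = ∑ i ∈ s, laurentD k (y i) * ∏ j ∈ s.erase i, y j := by
  induction s using Finset.induction_on with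
  | empty =>
    rw [Finset.prod_empty, Finset.sum_empty, ← T_zero, laurentD, laurentLin_T]
    simp
  | insert a s ha ih =>
    rw [Finset.prod_insert ha, laurentD_mul, Finset.sum_insert ha, Finset.erase_insert ha, ih,
      Finset.mul_sum]
    congr 1
    refine Finset.sum_congr rfl fun i hi => ?_
    have hia : a ≠ i := fun h => ha (h ▸ hi)
    rw [Finset.erase_insert_of_ne hia, Finset.prod_insert (fun h => ha (Finset.mem_of_mem_erase h))]
    ring

/-- This is the Leibniz rule: Δ^{(n)}(D) is the sum of D placed in each slot, and D is a derivation
of k[t, t⁻¹]. -/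
theorem act_coprod_X_mul {n : ℕ} (x : Fin n → k[T;T⁻¹]) (F : TPow k n) :
    act x (coprod k n X * F) = laurentD k (act x F) := by
  classical
  induction F using induction_pure with
  | hadd F G hF hG => simp only [mul_add, map_add, hF, hG]
  | hpure c f =>
    rw [mul_smul_comm, map_smul, map_smul, map_smul, coprod_X, Finset.sum_mul, map_sum, act_pure,
      laurentD_prod]
    congr 1
    refine Finset.sum_congr rfl fun i _ => ?_
    rw [single_apply, pure_mul_pure, act_pure, ← Finset.mul_prod_erase _ _ (Finset.mem_univ i)]
    congr 1
    · rw [Pi.mul_apply, Pi.mulSingle_eq_same, map_mul, aeval_X]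
      rfl
    · refine Finset.prod_congr rfl fun j hj => ?_
      rw [Pi.mul_apply, Pi.mulSingle_eq_of_ne (Finset.ne_of_mem_erase hj), one_mul]

theorem act_smul {n : ℕ} (x : Fin n → k[T;T⁻¹]) (h : k[X]) (F : TPow k n) :
    act x (h • F) = aeval (laurentD k) h (act x F) := by
  revert F
  refine poly_induct (p := fun h => ∀ F : TPow k n,
    act x (h • F) = aeval (laurentD k) h (act x F))
    (fun c F => ?_) (fun F => ?_) (fun p q hp hq F => ?_) (fun p q hp hq F => ?_) h
  · rw [Polynomial.C_eq_algebraMap, algebraMap_smul, map_smul, AlgHom.commutes,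
      Module.algebraMap_end_apply]
  · rw [smul_eq, act_coprod_X_mul, aeval_X]
  · rw [add_smul, map_add, hp, hq, map_add, LinearMap.add_apply]
  · rw [mul_smul, hp, hq, map_mul, Module.End.mul_apply]

theorem outer_add_left {n m : ℕ} (F F' : TPow k n) (G : TPow k m) :
    outer (F + F') G = outer F G + outer F' G := by
  simp only [outer, map_add, add_mul]

theorem outer_add_right {n m : ℕ} (F : TPow k n) (G G' : TPow k m) :
    outer F (G + G') = outer F G + outer F G' := by
  simp only [outer, map_add, mul_add]

theorem act_outer {n m : ℕ} (x : Fin (n + m) → k[T;T⁻¹]) (F : TPow k n) (G : TPow k m) :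
    act x (outer F G) =
      act (fun i => x (Fin.castAdd m i)) F * act (fun j => x (Fin.natAdd n j)) G := by
  induction F using induction_pure with
  | hadd F F' hF hF' => rw [outer_add_left, map_add, map_add, hF, hF', add_mul]
  | hpure c f =>
    induction G using induction_pure with
    | hadd G G' hG hG' => rw [outer_add_right, map_add, map_add, hG, hG', mul_add]
    | hpure d g =>
      have e : outer (c • pure f) (d • pure g) = (c * d) • outer (pure f) (pure g) := by
        simp only [outer, map_smul, smul_mul_smul_comm]
      rw [e, outer_pure, map_smul, map_smul, map_smul, act_pure, act_pure, act_pure,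
        Fin.prod_univ_add, smul_mul_smul_comm]
      simp

/-- The factor fᵢ lands in position σ(i), so it meets x_{σ(i)}. The same σ indexes the letters
a_{σ(i)} in f^*, so letters and Laurent polynomials stay paired. -/
theorem act_perm {n : ℕ} (x : Fin n → k[T;T⁻¹]) (σ : Equiv.Perm (Fin n)) (F : TPow k n) :
    act x (perm σ F) = act (fun i => x (σ i)) F := by
  induction F using induction_pure with
  | hadd F G hF hG => simp only [map_add, hF, hG]
  | hpure c f =>
    rw [map_smul, map_smul, map_smul, perm_pure, act_pure, act_pure, ← Equiv.prod_comp σ]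
    simp

/-- In p ⊗ 1 only the left block receives a coproduct, and multiplication by Δ^{(n)}(p) is by
definition the action of p on F. The coefficients of the pseudoproduct of a conformal algebra all
have this form. -/
theorem outer_mul_coprodPair {n m : ℕ} (F : TPow k n) (G : TPow k m) (p : k[X]) :
    outer F G * coprodPair k n m (pure ![p, 1]) = outer (p • F) G := by
  rw [coprodPair_pure, smul_eq, outer, outer, outer, map_one, map_one, mul_one, map_mul]
  ring

/-! ### Generators of H^{⊗(n+1)} over H -/

/-- The monomial `D^{α₁} ⊗ ⋯ ⊗ D^{αₙ} ⊗ 1` of `H^{⊗ (n+1)}`. -/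
noncomputable def monomial {n : ℕ} (α : Fin n → ℕ) : TPow k (n + 1) :=
  pure (Fin.snoc (fun i => X ^ α i) 1)

theorem monomial_zero {n : ℕ} : (monomial (0 : Fin n → ℕ) : TPow k (n + 1)) = 1 := by
  have : (Fin.snoc (fun i => X ^ (0 : Fin n → ℕ) i) 1 : Fin (n + 1) → k[X]) = 1 := by
    funext i
    refine Fin.lastCases ?_ (fun i => ?_) i <;> simp
  rw [monomial, this]
  rfl

theorem single_castSucc_mul_monomial {n : ℕ} (α : Fin n → ℕ) (i : Fin n) :
    (single i.castSucc X * monomial α : TPow k (n + 1)) = monomial (α + Pi.single i 1) := by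
  rw [single_apply, monomial, monomial, pure_mul_pure]
  congr 1
  funext j
  refine Fin.lastCases ?_ (fun j => ?_) j
  · simp
  · rcases eq_or_ne j i with rfl | hj
    · simp [pow_succ']
    · simp [hj]

/-- `H^{⊗ (n+1)}` is generated by the monomials `D^{α₁} ⊗ ⋯ ⊗ D^{αₙ} ⊗ 1` as an `H`-module. -/
theorem span_monomial (k : Type*) [Field k] (n : ℕ) :
    Submodule.span k[X] (Set.range (monomial : (Fin n → ℕ) → TPow k (n + 1))) = ⊤ := by
  set M := Submodule.span k[X] (Set.range (monomial : (Fin n → ℕ) → TPow k (n + 1))) with hM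
  have hcast (i : Fin n) (G : TPow k (n + 1)) (hG : G ∈ M) : single i.castSucc X * G ∈ M := by
    induction hG using Submodule.span_induction with
    | mem G hG =>
      obtain ⟨α, rfl⟩ := hG
      rw [single_castSucc_mul_monomial]
      exact Submodule.subset_span ⟨_, rfl⟩
    | zero => rw [mul_zero]; exact M.zero_mem
    | add G G' _ _ hG hG' => rw [mul_add]; exact M.add_mem hG hG'
    | smul h G _ hG => rw [mul_smul_comm]; exact M.smul_mem h hG
  have hX (i : Fin (n + 1)) (G : TPow k (n + 1)) (hG : G ∈ M) : single i X * G ∈ M := by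
    refine Fin.lastCases ?_ (fun i => hcast i G hG) i
    -- D in the last slot is traded for the H-action: Δ^{(n+1)}(D) minus D in each of the other
    -- slots.
    have e : single (Fin.last n) X * G =
        (X : k[X]) • G - ∑ i : Fin n, single i.castSucc X * G := by
      rw [smul_eq, coprod_X, Fin.sum_univ_castSucc, add_mul, Finset.sum_mul]
      ring
    rw [e]
    exact M.sub_mem (M.smul_mem _ hG) (M.sum_mem fun i _ => hcast i G hG)
  have hk (c : k) (G : TPow k (n + 1)) (hG : G ∈ M) : c • G ∈ M := by
    rw [← algebraMap_smul k[X] c G]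
    exact M.smul_mem _ hG
  have hsingle (i : Fin (n + 1)) (p : k[X]) : ∀ G ∈ M, single i p * G ∈ M := by
    refine poly_induct (p := fun p => ∀ G ∈ M, single i p * G ∈ M) (fun c G hG => ?_)
      (hX i) (fun p q hp hq G hG => ?_) (fun p q hp hq G hG => ?_) p
    · rw [Polynomial.C_eq_algebraMap, AlgHom.commutes, ← Algebra.smul_def]
      exact hk c G hG
    · rw [map_add, add_mul]
      exact M.add_mem (hp G hG) (hq G hG)
    · rw [map_mul, mul_assoc]
      exact hp _ (hq G hG)
  have hprod (s : Finset (Fin (n + 1))) (f : Fin (n + 1) → k[X]) :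
      ∏ i ∈ s, single i (f i) ∈ M := by
    induction s using Finset.induction_on with
    | empty =>
      rw [Finset.prod_empty, ← monomial_zero]
      exact Submodule.subset_span ⟨_, rfl⟩
    | insert a s ha ih =>
      rw [Finset.prod_insert ha]
      exact hsingle _ _ _ ih
  refine eq_top_iff.mpr fun F _ => ?_
  induction F using induction_pure with
  | hadd F G hF hG => exact M.add_mem (hF trivial) (hG trivial)
  | hpure c f =>
    rw [← prod_single f]
    exact hk c _ (hprod _ f)

end TPow

/-! ### Evaluation maps into the coefficient algebra -/

namespace Coeff

variable {k C : Type*} [Field k] [AddCommGroup C] [Module k[X] C]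

theorem mk_aeval (h : k[X]) (x : k[T;T⁻¹]) (a : C) :
    mk (aeval (laurentD k) h x) a = mk x (h • a) := by
  have e := Module.AEval.of_aeval_smul (laurentD k) h x
  rw [Module.End.smul_def] at e
  rw [mk, mk, ← TensorProduct.smul_tmul]
  exact congrArg (· ⊗ₜ[k[X]] a) e

/-- The map `H^{⊗ n} ⊗_H C → Coeff C` given by a tuple `x` of Laurent polynomials:
`(f₁ ⊗ ⋯ ⊗ fₙ) ⊗_H a ↦ ((f₁ x₁) ⋯ (fₙ xₙ)) ⊗_H a`. -/
noncomputable def evalTensor (C : Type*) [AddCommGroup C] [Module k[X] C] {n : ℕ}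
    (x : Fin n → k[T;T⁻¹]) : HTensor k n C →+ Coeff k C :=
  TensorProduct.liftAddHom
    (biAdd (fun (F : TPow k n) (a : C) => mk (TPow.act x F) a)
      (fun F F' a => by rw [map_add, mk_add_left])
      (fun F a a' => mk_add_right _ a a'))
    (fun h F a => by
      change mk (TPow.act x (h • F)) a = mk (TPow.act x F) (h • a)
      rw [TPow.act_smul, mk_aeval])

theorem evalTensor_tmul {n : ℕ} (x : Fin n → k[T;T⁻¹]) (F : TPow k n) (a : C) :
    evalTensor C x (F ⊗ₜ[k[X]] a) = mk (TPow.act x F) a := rfl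

theorem evalTensor_smul {n : ℕ} (x : Fin n → k[T;T⁻¹]) (c : k) (ξ : HTensor k n C) :
    evalTensor C x (c • ξ) = c • evalTensor C x ξ := by
  induction ξ using TensorProduct.induction_on with
  | zero => rw [smul_zero, map_zero, smul_zero]
  | add ξ η hξ hη => rw [smul_add, map_add, map_add, smul_add, hξ, hη]
  | tmul F a =>
    rw [TensorProduct.smul_tmul', evalTensor_tmul, evalTensor_tmul, map_smul, mk_smul]

theorem evalTensor_permTensor {n : ℕ} (x : Fin n → k[T;T⁻¹]) (σ : Equiv.Perm (Fin n))
    (ξ : HTensor k n C) :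
    evalTensor C x (MultilinearPoly.permTensor C σ ξ) = evalTensor C (fun i => x (σ i)) ξ := by
  induction ξ using TensorProduct.induction_on with
  | zero => simp only [map_zero]
  | add ξ η hξ hη => simp only [map_add, hξ, hη]
  | tmul F a =>
    change mk (TPow.act x (TPow.perm σ F)) a = mk (TPow.act _ F) a
    rw [TPow.act_perm]

/-- Up to sign and factorial, powers of D are divided-power derivatives: each further D contributes
a factor -(s + 1). -/
theorem laurentD_pow_apply (s : ℕ) (x : k[T;T⁻¹]) :
    (laurentD k ^ s) x = ((-1) ^ s * (s.factorial : k)) • laurentHasse k s x := by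
  induction s with
  | zero =>
    have h : laurentHasse k 0 = LinearMap.id :=
      laurent_ext fun n => by simp [laurentHasse, laurentLin_T]
    simp [h]
  | succ s ih =>
    rw [pow_succ', Module.End.mul_apply, ih, map_smul, laurentD_hasse, smul_neg, smul_smul,
      ← neg_smul, Nat.factorial_succ]
    congr 1
    push_cast
    ring

/-- The point where the coefficients of the pseudoproduct match the binomials in the product of
Coeff C. Characteristic 0 is needed to cancel s!. -/
theorem aeval_laurentD_neg_X_pow [CharZero k] (s : ℕ) (x : k[T;T⁻¹]) :
    aeval (laurentD k) (Polynomial.C ((s.factorial : k)⁻¹) * (-X) ^ s) x = laurentHasse k s x := by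
  have h : (s.factorial : k) ≠ 0 := Nat.cast_ne_zero.mpr s.factorial_ne_zero
  have e : Polynomial.C ((s.factorial : k)⁻¹) * (-X) ^ s =
      ((s.factorial : k)⁻¹ * (-1) ^ s) • (X : k[X]) ^ s := by
    rw [Polynomial.smul_eq_C_mul, neg_pow (X : k[X]) s]
    simp only [map_mul, map_pow, map_neg, map_one]
    ring
  rw [e, map_smul, map_pow, aeval_X, LinearMap.smul_apply, laurentD_pow_apply, smul_smul]
  have h' : ((s.factorial : k)⁻¹ * (-1) ^ s) * ((-1) ^ s * (s.factorial : k)) = 1 := by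
    rw [show ((s.factorial : k)⁻¹ * (-1) ^ s) * ((-1) ^ s * (s.factorial : k)) =
      ((s.factorial : k)⁻¹ * (s.factorial : k)) * ((-1) * (-1)) ^ s by rw [mul_pow]; ring,
      inv_mul_cancel₀ h]
    simp
  rw [h', one_smul]

variable [Module k C] [IsScalarTower k k[X] C] [ConformalAlgebra k C]

open ConformalAlgebra

/-- By additivity it suffices to compare pure tensors F ⊗_H a and G ⊗_H b, and there the two sides
agree summand by summand in s: the coefficient (-D)^s/s! acts on the product of the left block, as
the divided-power derivative does in the product of Coeff C. -/
theorem evalTensor_expanded [CharZero k] {n m : ℕ} (x : Fin (n + m) → k[T;T⁻¹])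
    (ξ : HTensor k n C) (η : HTensor k m C) :
    evalTensor C x (Pseudoalgebra.expanded ξ η) =
      evalTensor C (fun i => x (Fin.castAdd m i)) ξ *
        evalTensor C (fun j => x (Fin.natAdd n j)) η := by
  induction ξ using TensorProduct.induction_on with
  | zero => rw [map_zero, map_zero, AddMonoidHom.zero_apply, map_zero, zero_mul]
  | add ξ ξ' hξ hξ' =>
    rw [map_add, AddMonoidHom.add_apply, map_add, map_add, add_mul, hξ, hξ']
  | tmul F a =>
    induction η using TensorProduct.induction_on with
    | zero => rw [map_zero, map_zero, map_zero, mul_zero]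
    | add η η' hη hη' => rw [map_add, map_add, map_add, mul_add, hη, hη']
    | tmul G b =>
      rw [Pseudoalgebra.expanded_tmul, evalTensor_tmul, evalTensor_tmul, mk_mul_mk, preMul]
      change evalTensor C x (TPow.outer F G • Pseudoalgebra.coprodPairTensor k C n m
        (sumProd (k := k) (pterm k C) a b)) = _
      rw [← LinearMap.toAddMonoidHom_coe, sumProd_map, smul_sumProd, sumProd_map]
      refine sumProd_congr (fun s c => ?_) a b
      change mk (TPow.act x (TPow.outer F G * TPow.coprodPair k n m
        (TPow.pure ![Polynomial.C ((s.factorial : k)⁻¹) * (-X) ^ s, 1]))) c = mk _ c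
      rw [TPow.outer_mul_coprodPair, TPow.act_outer, TPow.act_smul, aeval_laurentD_neg_X_pow]

theorem evalTensor_pseudoEval [CharZero k] {n : ℕ} (w : Bracketing n) (x : Fin n → k[T;T⁻¹])
    (a : Fin n → C) :
    evalTensor C x (w.pseudoEval (k := k) a) = w.eval (fun i => mk (x i) (a i)) := by
  induction w with
  | leaf =>
    have e : (1 : TPow k 1) = TPow.pure 1 := rfl
    rw [Bracketing.pseudoEval, Bracketing.eval, evalTensor_tmul, e, TPow.act_pure]
    simp
  | node u v hu hv =>
    rw [Bracketing.pseudoEval, Bracketing.eval, evalTensor_expanded, hu, hv]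

/-- The values `f(a₁(x₁), …, aₙ(xₙ))` in the coefficient algebra are the images of
`f^*(a₁, …, aₙ)`. -/
theorem evalTensor_multilinearPoly [CharZero k] {n : ℕ} (f : MultilinearPoly k n)
    (x : Fin n → k[T;T⁻¹]) (a : Fin n → C) :
    evalTensor C x (f.pseudoEval a) = f.eval (fun i => (mk (x i) (a i) : Coeff k C)) := by
  rw [MultilinearPoly.pseudoEval, MultilinearPoly.eval, map_sum]
  refine Finset.sum_congr rfl fun σ _ => ?_
  rw [evalTensor_permTensor, Finsupp.sum, map_sum]
  refine Finset.sum_congr rfl fun w _ => ?_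
  rw [evalTensor_smul, evalTensor_pseudoEval]

end Coeff

/-! ### The projection of Laurent polynomials onto their principal part -/

/-- The projection of `k[t, t⁻¹]` onto its free `H`-submodule generated by `t⁻¹`, along `k[t]`:
`t^{-m-1} ↦ D^m / m!`. -/
noncomputable def laurentPrincipal (k : Type*) [Field k] : k[T;T⁻¹] →ₗ[k] k[X] :=
  (AddMonoidAlgebra.basis ℤ k).constr k fun n =>
    if n < 0 then Polynomial.C (((-n - 1).toNat.factorial : k)⁻¹) * X ^ (-n - 1).toNat else 0

theorem laurentPrincipal_T {k : Type*} [Field k] (n : ℤ) : laurentPrincipal k (T n) =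
    if n < 0 then Polynomial.C (((-n - 1).toNat.factorial : k)⁻¹) * X ^ (-n - 1).toNat else 0 :=
  (AddMonoidAlgebra.basis ℤ k).constr_basis k _ n

theorem laurentPrincipal_T_of_nonneg {k : Type*} [Field k] {n : ℤ} (hn : 0 ≤ n) :
    laurentPrincipal k (T n) = 0 := by
  rw [laurentPrincipal_T, if_neg (not_lt.mpr hn)]

theorem laurentPrincipal_T_neg_succ {k : Type*} [Field k] (m : ℕ) :
    laurentPrincipal k (T (-(m : ℤ) - 1)) = Polynomial.C ((m.factorial : k)⁻¹) * X ^ m := by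
  rw [laurentPrincipal_T, if_pos (by omega), show (-(-(m : ℤ) - 1) - 1).toNat = m by omega]

theorem laurentPrincipal_laurentD {k : Type*} [Field k] [CharZero k] (x : k[T;T⁻¹]) :
    laurentPrincipal k (laurentD k x) = (X : k[X]) • laurentPrincipal k x := by
  have h : laurentPrincipal k ∘ₗ laurentD k =
      LinearMap.mulLeft k (X : k[X]) ∘ₗ laurentPrincipal k := by
    refine laurent_ext fun n => ?_
    simp only [LinearMap.comp_apply, LinearMap.mulLeft_apply, laurentD, laurentLin_T, map_neg,
      map_smul]
    rcases lt_trichotomy n 0 with hn | rfl | hn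
    · obtain ⟨m, rfl⟩ : ∃ m : ℕ, n = -(m : ℤ) - 1 := ⟨(-n - 1).toNat, by omega⟩
      rw [show -(m : ℤ) - 1 - 1 = -((m + 1 : ℕ) : ℤ) - 1 by push_cast; ring,
        laurentPrincipal_T_neg_succ, laurentPrincipal_T_neg_succ,
        ← ConformalAlgebra.inv_factorial_succ m, Polynomial.smul_eq_C_mul]
      push_cast
      simp only [map_sub, map_neg, map_add, map_one, map_mul]
      ring
    -- The boundary case: t⁻¹ is not killed by the projection, but it appears with coefficient n =
    -- 0. This is why k[t] is stable under D.
    · rw [laurentPrincipal_T_of_nonneg le_rfl]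
      simp
    · rw [laurentPrincipal_T_of_nonneg (by omega), laurentPrincipal_T_of_nonneg hn.le]
      simp
  exact LinearMap.congr_fun h x

/-- `laurentPrincipal` as an `H`-linear map. -/
noncomputable def laurentPrincipalH (k : Type*) [Field k] [CharZero k] : LaurentH k →ₗ[k[X]] k[X] :=
  LinearMap.ofAEval (laurentD k) (laurentPrincipal k) laurentPrincipal_laurentD

namespace Coeff

variable {k C : Type*} [Field k] [CharZero k] [AddCommGroup C] [Module k[X] C]

/-- The map `Coeff C → C`, `a(-m-1) ↦ (D^m / m!) a` and `a(m) ↦ 0` for `m ≥ 0`. -/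
noncomputable def principal : Coeff k C →+ C :=
  (TensorProduct.lift ((LinearMap.lsmul k[X] C).comp (laurentPrincipalH k))).toAddMonoidHom

theorem principal_mk (x : k[T;T⁻¹]) (a : C) : principal (mk x a) = laurentPrincipal k x • a := rfl

end Coeff

/-! ### Monomials evaluated at the test points -/

theorem laurentD_pow_T {k : Type*} [Field k] (m s : ℕ) :
    (laurentD k ^ s) (T (m : ℤ)) =
      ((-1) ^ s * (m.descFactorial s : k)) • T ((m : ℤ) - s) := by
  induction s with
  | zero => simp
  | succ s ih =>
    rw [pow_succ', Module.End.mul_apply, ih, map_smul, laurentD, laurentLin_T, smul_neg, smul_smul,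
      ← neg_smul, Nat.descFactorial_succ]
    -- The truncated subtraction m - s is the true one only for s ≤ m; beyond that both sides carry
    -- the zero factor `m.descFactorial s`.
    rcases le_or_gt s m with h | h
    · rw [show ((m : ℤ) - s - 1) = (m : ℤ) - (s + 1 : ℕ) by push_cast; ring]
      congr 1
      push_cast [Nat.cast_sub h]
      ring
    · rw [Nat.descFactorial_eq_zero_iff_lt.mpr h]
      simp

/-- The tuple `(t^{β₁}, …, t^{βₙ}, t⁻¹)`. -/
noncomputable def laurentPoint (k : Type*) [Field k] {n : ℕ} (β : Fin n → ℕ) :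
    Fin (n + 1) → k[T;T⁻¹] :=
  Fin.snoc (fun i => T (β i : ℤ)) (T (-1))

theorem act_laurentPoint_monomial {k : Type*} [Field k] {n : ℕ} (β α : Fin n → ℕ) :
    TPow.act (laurentPoint k β) (TPow.monomial α) =
      (∏ i, ((-1) ^ α i * ((β i).descFactorial (α i) : k))) •
        T (∑ i, ((β i : ℤ) - α i) - 1) := by
  have hT (s : Finset (Fin n)) (u : Fin n → ℤ) :
      ∏ i ∈ s, (T (u i) : k[T;T⁻¹]) = T (∑ i ∈ s, u i) := by
    induction s using Finset.induction_on with
    | empty => simp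
    | insert a s ha ih => rw [Finset.prod_insert ha, Finset.sum_insert ha, ih, T_add]
  rw [TPow.monomial, TPow.act_pure, Fin.prod_univ_castSucc]
  simp only [laurentPoint, Fin.snoc_castSucc, Fin.snoc_last, map_pow, aeval_X, map_one,
    laurentD_pow_T, Finset.prod_smul, hT, Module.End.one_apply]
  rw [smul_mul_assoc, ← T_add, sub_eq_add_neg (∑ i, _)]

/-- Two different causes of vanishing: too few derivatives in some slot, and none in excess, leave a
power of t in k[t], while too many in some slot already give 0. -/
theorem laurentPrincipal_act_of_ne {k : Type*} [Field k] {n : ℕ} {β α : Fin n → ℕ} (h : α ≠ β) :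
    laurentPrincipal k (TPow.act (laurentPoint k β) (TPow.monomial α)) = 0 := by
  rw [act_laurentPoint_monomial, map_smul]
  by_cases hle : α ≤ β
  · obtain ⟨i, hi⟩ : ∃ i, α i < β i := by
      by_contra! hc
      exact h (le_antisymm hle hc)
    -- A sum of at least 1 absorbs the exponent -1 of the last entry t⁻¹, so the total exponent is
    -- nonnegative.
    have hpos : 0 < ∑ i, ((β i : ℤ) - α i) :=
      Finset.sum_pos' (fun j _ => by have : α j ≤ β j := hle j; omega) ⟨i, Finset.mem_univ i, by omega⟩
    rw [laurentPrincipal_T_of_nonneg (by omega), smul_zero]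
  · obtain ⟨i, hi⟩ : ∃ i, β i < α i := by
      by_contra! hc
      exact hle hc
    rw [Finset.prod_eq_zero (Finset.mem_univ i)
      (by rw [Nat.descFactorial_eq_zero_iff_lt.mpr hi, Nat.cast_zero, mul_zero]), zero_smul]

/-- The derivatives exhaust all the t^{βᵢ}, leaving a multiple of t⁻¹, the generator sent to 1. -/
theorem laurentPrincipal_act_self {k : Type*} [Field k] {n : ℕ} (β : Fin n → ℕ) :
    laurentPrincipal k (TPow.act (laurentPoint k β) (TPow.monomial β)) =
      Polynomial.C (∏ i, ((-1) ^ β i * ((β i).factorial : k))) := by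
  have h := laurentPrincipal_T_neg_succ (k := k) 0
  simp only [Nat.cast_zero, neg_zero, Nat.factorial_zero, Nat.cast_one, inv_one, pow_zero, map_one,
    mul_one] at h
  rw [act_laurentPoint_monomial, map_smul]
  simp only [sub_self, Finset.sum_const_zero, h, Nat.descFactorial_self]
  rw [Polynomial.smul_eq_C_mul, mul_one]

/-! ### Separation of points -/

namespace HTensor

variable {k C : Type*} [Field k] [AddCommGroup C] [Module k[X] C]

/-- The map `(c_α)_α ↦ ∑ α, (D^{α₁} ⊗ ⋯ ⊗ D^{αₙ} ⊗ 1) ⊗_H c_α`. -/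
noncomputable def ofCoeffs (k C : Type*) [Field k] [AddCommGroup C] [Module k[X] C] (n : ℕ) :
    ((Fin n → ℕ) →₀ C) →+ HTensor k (n + 1) C :=
  Finsupp.liftAddHom fun α => (TensorProduct.mk k[X] (TPow k (n + 1)) C
    (TPow.monomial α)).toAddMonoidHom

theorem ofCoeffs_apply {n : ℕ} (c : (Fin n → ℕ) →₀ C) :
    ofCoeffs k C n c = c.sum fun α a => TPow.monomial α ⊗ₜ[k[X]] a := rfl

/-- The monomials generate H^{⊗(n+1)} over H, and scalars from H move across ⊗_H into C.
Independence of the monomials is not required. -/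
theorem ofCoeffs_surjective (n : ℕ) : Function.Surjective (ofCoeffs k C n) := by
  intro ξ
  induction ξ using TensorProduct.induction_on with
  | zero => exact ⟨0, map_zero _⟩
  | add ξ η hξ hη =>
    obtain ⟨c, rfl⟩ := hξ
    obtain ⟨d, rfl⟩ := hη
    exact ⟨c + d, map_add _ c d⟩
  | tmul F a =>
    have hF : F ∈ Submodule.span k[X] (Set.range (TPow.monomial : (Fin n → ℕ) → TPow k (n + 1))) :=
      TPow.span_monomial k n ▸ Submodule.mem_top
    induction hF using Submodule.span_induction generalizing a with
    | mem F hF =>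
      obtain ⟨α, rfl⟩ := hF
      exact ⟨Finsupp.single α a, Finsupp.liftAddHom_apply_single _ _ _⟩
    | zero => exact ⟨0, by rw [map_zero, TensorProduct.zero_tmul]⟩
    | add F G _ _ hF hG =>
      obtain ⟨c, hc⟩ := hF a
      obtain ⟨d, hd⟩ := hG a
      exact ⟨c + d, by rw [map_add, hc, hd, TensorProduct.add_tmul]⟩
    | smul h F _ hF =>
      obtain ⟨c, hc⟩ := hF (h • a)
      exact ⟨c, by rw [hc, TensorProduct.smul_tmul]⟩

/-- The maps `H^{⊗ (n+1)} ⊗_H C → Coeff C` separate points. -/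
theorem eq_zero_of_evalTensor_eq_zero [CharZero k] {n : ℕ} (ξ : HTensor k (n + 1) C)
    (h : ∀ x : Fin (n + 1) → k[T;T⁻¹], Coeff.evalTensor C x ξ = 0) : ξ = 0 := by
  obtain ⟨c, rfl⟩ := ofCoeffs_surjective n ξ
  have hc : c = 0 := by
    refine Finsupp.ext fun β => ?_
    -- The test point with exponents β isolates the single coefficient c_β.
    have e := congrArg Coeff.principal (h (laurentPoint k β))
    rw [map_zero, ofCoeffs_apply, Finsupp.sum, map_sum, map_sum] at e
    simp only [Coeff.evalTensor_tmul, Coeff.principal_mk] at e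
    rw [Finset.sum_eq_single β
      (fun α _ hα => by rw [laurentPrincipal_act_of_ne hα, zero_smul])
      (fun hβ => by rw [Finsupp.notMem_support_iff.mp hβ, smul_zero]),
      laurentPrincipal_act_self] at e
    set d : k := ∏ i, ((-1) ^ β i * ((β i).factorial : k)) with hd
    have hd0 : d ≠ 0 := Finset.prod_ne_zero_iff.mpr fun i _ =>
      mul_ne_zero (pow_ne_zero _ (neg_ne_zero.mpr one_ne_zero))
        (Nat.cast_ne_zero.mpr (Nat.factorial_ne_zero _))
    have e' := congrArg (Polynomial.C d⁻¹ • ·) e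
    simpa only [smul_smul, ← Polynomial.C_mul, inv_mul_cancel₀ hd0, map_one, one_smul,
      smul_zero, Finsupp.coe_zero, Pi.zero_apply] using e'
  rw [hc, map_zero]

end HTensor

/-! ### Conclusion -/

theorem Bracketing.length_pos {n : ℕ} (w : Bracketing n) : 0 < n := by
  induction w with
  | leaf => exact one_pos
  | node u v hu hv => omega

theorem mainTheorem1 {k C : Type*} [Field k] [CharZero k] [AddCommGroup C] [Module k C]
    [Module k[X] C] [IsScalarTower k k[X] C] [ConformalAlgebra k C] {n : ℕ}
    (f : MultilinearPoly k n) (hf : SatisfiesIdentity (Coeff k C) f) :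
    SatisfiesPseudoIdentity C f := by
  intro a
  cases n with
  | zero =>
    -- The separation argument reserves one tensor factor for t⁻¹, so n = 0 is handled apart: the
    -- empty word has no bracketing, hence f^* is an empty combination.
    have : IsEmpty (Bracketing 0) := ⟨fun w => absurd w.length_pos (lt_irrefl 0)⟩
    refine Finset.sum_eq_zero fun σ _ => ?_
    rw [Subsingleton.elim (f σ) 0, Finsupp.sum_zero_index, map_zero]
  | succ n =>
    refine HTensor.eq_zero_of_evalTensor_eq_zero _ fun x => ?_
    rw [Coeff.evalTensor_multilinearPoly]
    exact hf _
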